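/- Let $n\ge 1$ and let $U$ be a finite set of actions. Consider the system $x_{k+1}=f(x_k,u_k)+v_k$ on $\mathbb{R}^n$, where each $f(\cdot,a)$ is measurable and the $v_k$ are i.i.d. with a probability density supported in $\{v:\|v\|_\infty\le\sigma\}$, $\sigma>0$. Let $M$ be the Markov decision process with transition kernel $T(x,a,W)=\mathbb{P}(f(x,a)+v\in W)$ and labeling $L:\mathbb{R}^n\to 2^{AP}$. Let $X\subset\mathbb{R}^n$ be compact, let $\overline Q$ be a finite partition of $X$ into nonempty Borel regions, and let $Q=\overline Q\cup\{q_u\}$ with $q_u=\mathbb{R}^n\setminus X$; assume that $L$ is constant on each $q\in Q$. Let $\mathcal I$ be an interval MDP (IMDP) abstraction of $M$: its states are $Q$, its actions are $U$, its labeling satisfies $L_{\mathcal I}(q)=L(x)$ for $x\in q$, and its transition bounds $\check P,\hat P:Q\times U\times Q\to[0,1]$ satisfy $\check P(q,a,q')\le T(x,a,q')\le\hat P(q,a,q')$ for all $q,q'\in Q$, $a\in U$, $x\in q$. Let $\varphi$ be a safe LTL formula over $AP$ (built from $\mathrm p$ and $\neg\mathrm p$, $\mathrm p\in AP$, by $\wedge,\vee,\bigcirc,\square$,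 and interpreted over infinite traces in $2^{AP}$). Let $\mathcal A=(Z,z_0,2^{AP},\delta,Z_f)$ be a deterministic finite automaton for $\neg\varphi$: for every infinite trace $\rho$, the run $z_{i+1}=\delta(z_i,\rho_i)$ from $z_0$ visits $Z_f$ if and only if $\rho\not\models\varphi$. The product IMDP $\mathcal I_{\mathcal A}$ has states $Q\times Z$ and actions $U$; its bounds from $(q,z)$ to $(q',z')$ under $a$ are $\check P(q,a,q')$ and $\hat P(q,a,q')$ if $z'=\delta(z,L_{\mathcal I}(q))$, and both $0$ otherwise. An adversary $\Delta$ chooses for each product state and action a probability distribution of the next product state within these bounds. The observation trace of a path $(q_0,z_0)(q_1,z_1)\dots$ of the product is $L_{\mathcal I}(q_0)L_{\mathcal I}(q_1)\dots$. Let $\pi:Q\times Z\to U$ be a stationary policy on $\mathcal I_{\mathcal A}$, used on $M$ as the policy that plays $\pi(q,z)$ when the current state lies in $q$ and the automaton, having read the labels of all previous states, is in state $z$. (Thus the policy is constant on each region; if $\pi$ does not depend on $z$, it is a policy on $Q$ with $\pi(x)=\pi(q)$ for all $x\in q$.) Then, for every $q\in Q$ and every $p$, if $$\sup_{\Delta}\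 \mathbb{P}\big(\mathcal I_{\mathcal A}^{\pi,\Delta}\models\neg\varphi \,\big|\, \bar x_0=(q,z_0)\big)<p,$$ then $\mathbb{P}\big(M^{\pi}\models\neg\varphi \,\big|\, x_0\big)<p$ for every initial state $x_0\in q$. -/

import Mathlib

open MeasureTheory ProbabilityTheory
open scoped ENNReal

namespace Shield

/-! ### Safe LTL over infinite observation traces -/

/-- Syntactically safe LTL formulas over the atomic propositions `AP`. -/
inductive SafeLTL (AP : Type*) where
  | atom : AP → SafeLTL AP
  | natom : AP → SafeLTL AP
  | and : SafeLTL AP → SafeLTL AP → SafeLTL AP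
  | or : SafeLTL AP → SafeLTL AP → SafeLTL AP
  | next : SafeLTL AP → SafeLTL AP
  | always : SafeLTL AP → SafeLTL AP

/-- `φ.Sat ρ`: the infinite trace `ρ₀ ρ₁ …` of sets of propositions satisfies `φ`. -/
def SafeLTL.Sat {AP : Type*} : SafeLTL AP → (ℕ → Set AP) → Prop
  | .atom a, ρ => a ∈ ρ 0
  | .natom a, ρ => a ∉ ρ 0
  | .and φ ψ, ρ => φ.Sat ρ ∧ ψ.Sat ρ
  | .or φ ψ, ρ => φ.Sat ρ ∨ ψ.Sat ρ
  | .next φ, ρ => φ.Sat (fun i => ρ (i + 1))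
  | .always φ, ρ => ∀ k, φ.Sat (fun i => ρ (i + k))

/-! ### Automata reading infinite traces -/

/-- The run `z₀ z₁ …` of a DFA on an infinite trace: `z_{i+1} = δ(z_i, ρ_i)`. -/
def dfaRun {α Z : Type*} (A : DFA α Z) (ρ : ℕ → α) : ℕ → Z
  | 0 => A.start
  | k + 1 => A.step (dfaRun A ρ k) (ρ k)

/-- `A` is a DFA for `¬φ`: an infinite trace is accepted (its run meets a final state)
exactly when it violates `φ`. -/
def IsDFAForNegation {AP Z : Type*} (A : DFA (Set AP) Z) (φ : SafeLTL AP) : Prop :=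
  ∀ ρ : ℕ → Set AP, (∃ i, dfaRun A ρ i ∈ A.accept) ↔ ¬ φ.Sat ρ

/-! ### Path measures -/

/-- The law of the random path `ω 0, ω 1, …` that starts in `x₀` and whose next state, given the
history up to time `k`, is drawn from `κ k` (Ionescu-Tulcea). -/
noncomputable def pathLaw {S : Type*} [MeasurableSpace S]
    (κ : (k : ℕ) → Kernel (Finset.Iic k → S) S) [∀ k, IsMarkovKernel (κ k)] (x₀ : S) :
    Measure (ℕ → S) :=
  Kernel.traj (X := fun _ => S) κ 0 (fun _ => x₀)

/-- The last state of a history of states up to time `k`. -/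
def lastState {S : Type*} {k : ℕ} (h : Finset.Iic k → S) : S :=
  h ⟨k, Finset.mem_Iic.2 le_rfl⟩

/-! ### The continuous-state MDP -/

/-- The MDP of the system `x(k+1) = f(x(k), u(k)) + v(k)` on `ℝⁿ`: the noise has density `density`
with respect to Lebesgue measure, supported in `{v | ‖v‖_∞ ≤ σ}` (the norm of `Fin n → ℝ` is the
sup norm); `X` is the compact set of interest, `label x` the set of propositions true at `x`. -/
structure ContMDP (n : ℕ) (U AP : Type*) where
  f : (Fin n → ℝ) → U → (Fin n → ℝ)
  measurable_f : ∀ a, Measurable fun x => f x a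
  σ : ℝ
  σ_pos : 0 < σ
  density : (Fin n → ℝ) → ℝ≥0∞
  measurable_density : Measurable density
  lintegral_density : ∫⁻ v, density v = 1
  density_eq_zero : ∀ v, σ < ‖v‖ → density v = 0
  X : Set (Fin n → ℝ)
  isCompact_X : IsCompact X
  label : (Fin n → ℝ) → Set AP

namespace ContMDP

variable {n : ℕ} {U AP : Type*} (M : ContMDP n U AP)

/-- The law of the noise `v(k)`. -/
noncomputable def noise : Measure (Fin n → ℝ) := volume.withDensity M.density

instance : IsProbabilityMeasure M.noise :=
  ⟨by rw [noise, withDensity_apply _ MeasurableSet.univ, Measure.restrict_univ,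
    M.lintegral_density]⟩

/-- The transition kernel: `T x a W` is the probability that `f x a + v ∈ W`. -/
noncomputable def T (x : Fin n → ℝ) (a : U) : Measure (Fin n → ℝ) :=
  M.noise.map fun v => M.f x a + v

instance (x : Fin n → ℝ) (a : U) : IsProbabilityMeasure (M.T x a) :=
  Measure.isProbabilityMeasure_map (by fun_prop)

lemma measurable_T (a : U) : Measurable fun x => M.T x a := by
  refine Measure.measurable_of_measurable_coe _ fun s hs => ?_
  have hm : Measurable fun y : (Fin n → ℝ) × (Fin n → ℝ) => M.f y.1 a + y.2 :=
    ((M.measurable_f a).comp measurable_fst).add measurable_snd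
  have : (fun x => M.T x a s) = fun x =>
      M.noise (Prod.mk x ⁻¹' ((fun y : (Fin n → ℝ) × (Fin n → ℝ) => M.f y.1 a + y.2) ⁻¹' s)) := by
    funext x
    rw [T, Measure.map_apply (by fun_prop) hs]
    rfl
  rw [this]
  exact measurable_measure_prodMk_left (hm hs)

end ContMDP

/-- A (history-dependent, deterministic) policy: it maps a finite path `x₀ … x_k` to an action.
The past actions are not listed since they are determined by the policy and the past states. -/
structure Policy (n : ℕ) (U : Type*) where
  act : (k : ℕ) → (Finset.Iic k → (Fin n → ℝ)) → U
  measurableSet_act : ∀ k a, MeasurableSet {h | act k h = a}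

namespace ContMDP

variable {n : ℕ} {U AP : Type*} [Countable U] (M : ContMDP n U AP)

/-- One step of `M` under a policy: the law of `x_{k+1}` given `x₀ … x_k`. -/
noncomputable def stepKernel (π : Policy n U) (k : ℕ) :
    Kernel (Finset.Iic k → (Fin n → ℝ)) (Fin n → ℝ) where
  toFun h := M.T (lastState h) (π.act k h)
  measurable' := by
    intro B hB
    have : (fun h => M.T (lastState h) (π.act k h)) ⁻¹' B =
        ⋃ a : U, {h | π.act k h = a} ∩ (fun h => M.T (lastState h) a) ⁻¹' B := by
      ext h
      simp
    rw [this]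
    refine MeasurableSet.iUnion fun a => (π.measurableSet_act k a).inter ?_
    exact ((M.measurable_T a).comp (measurable_pi_apply _)) hB

instance (π : Policy n U) (k : ℕ) : IsMarkovKernel (M.stepKernel π k) :=
  ⟨fun h => inferInstanceAs (IsProbabilityMeasure (M.T (lastState h) (π.act k h)))⟩

/-- The probability that `M` under `π`, started in `x₀`, violates `φ`. -/
noncomputable def violationProb (π : Policy n U) (φ : SafeLTL AP) (x₀ : Fin n → ℝ) : ℝ≥0∞ :=
  pathLaw (M.stepKernel π) x₀ {ω | ¬ φ.Sat fun i => M.label (ω i)}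

end ContMDP

/-! ### Interval MDPs -/

/-- An interval MDP with states `S`, actions `U`, transition bounds `lower`, `upper` and labels. -/
structure IMDP (S U AP : Type*) where
  lower : S → U → S → ℝ
  upper : S → U → S → ℝ
  lower_mem : ∀ s a s', lower s a s' ∈ Set.Icc (0 : ℝ) 1
  upper_mem : ∀ s a s', upper s a s' ∈ Set.Icc (0 : ℝ) 1
  label : S → Set AP

/-- An adversary picks, for each state and action, a distribution within the bounds. -/
structure IMDP.Adversary {S U AP : Type*} [Fintype S] (I : IMDP S U AP) where
  prob : S → U → S → ℝ
  sum_eq_one : ∀ s a, ∑ s', prob s a s' = 1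
  lower_le : ∀ s a s', I.lower s a s' ≤ prob s a s'
  le_upper : ∀ s a s', prob s a s' ≤ I.upper s a s'

namespace IMDP

variable {S U AP : Type*} [Fintype S] {I : IMDP S U AP}

/-- The distribution of the next state from `s` under action `a` and adversary `Δ`. -/
noncomputable def Adversary.next [MeasurableSpace S] (Δ : I.Adversary) (s : S) (a : U) :
    Measure S :=
  ∑ s', ENNReal.ofReal (Δ.prob s a s') • Measure.dirac s'

instance [MeasurableSpace S] (Δ : I.Adversary) (s : S) (a : U) :
    IsProbabilityMeasure (Δ.next s a) := by
  refine ⟨?_⟩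
  have h0 : ∀ s' ∈ Finset.univ, 0 ≤ Δ.prob s a s' := fun s' _ =>
    (I.lower_mem s a s').1.trans (Δ.lower_le s a s')
  simp [Adversary.next, ← ENNReal.ofReal_sum_of_nonneg h0, Δ.sum_eq_one]

/-- One step of the Markov chain given by an adversary and a stationary policy. -/
noncomputable def Adversary.stepKernel [MeasurableSpace S] [DiscreteMeasurableSpace S]
    (Δ : I.Adversary) (π : S → U) (k : ℕ) : Kernel (Finset.Iic k → S) S where
  toFun h := Δ.next (lastState h) (π (lastState h))
  measurable' := (Measurable.of_discrete (f := fun s : S => Δ.next s (π s))).comp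
    (measurable_pi_apply _)

instance [MeasurableSpace S] [DiscreteMeasurableSpace S] (Δ : I.Adversary) (π : S → U) (k : ℕ) :
    IsMarkovKernel (Δ.stepKernel π k) :=
  ⟨fun h => inferInstanceAs (IsProbabilityMeasure (Δ.next (lastState h) (π (lastState h))))⟩

/-- The probability that the chain given by `π` and `Δ`, started in `s₀`, produces an observation
trace that satisfies `¬φ`; the finite state space carries its discrete `σ`-algebra. -/
noncomputable def Adversary.violationProb (Δ : I.Adversary) (π : S → U) (φ : SafeLTL AP)
    (s₀ : S) : ℝ≥0∞ :=
  letI : MeasurableSpace S := ⊤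
  haveI : DiscreteMeasurableSpace S := ⟨fun _ => trivial⟩
  pathLaw (Δ.stepKernel π) s₀ {ω | ¬ φ.Sat fun i => I.label (ω i)}

/-- The worst-case probability, over all adversaries, of satisfying `¬φ` from `s₀` under `π`. -/
noncomputable def worstViolationProb (I : IMDP S U AP) (π : S → U) (φ : SafeLTL AP) (s₀ : S) :
    ℝ≥0∞ :=
  ⨆ Δ : I.Adversary, Δ.violationProb π φ s₀

end IMDP

open Classical in
/-- The product of an IMDP with a DFA: the automaton reads the label of the current state. -/
noncomputable def IMDP.product {Q U AP Z : Type*} (I : IMDP Q U AP) (A : DFA (Set AP) Z) :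
    IMDP (Q × Z) U AP where
  lower s a s' := if s'.2 = A.step s.2 (I.label s.1) then I.lower s.1 a s'.1 else 0
  upper s a s' := if s'.2 = A.step s.2 (I.label s.1) then I.upper s.1 a s'.1 else 0
  lower_mem s a s' := by
    split_ifs
    · exact I.lower_mem _ _ _
    · simp
  upper_mem s a s' := by
    split_ifs
    · exact I.upper_mem _ _ _
    · simp
  label s := I.label s.1

/-! ### The abstraction -/

/-- A finite partition of `X` into nonempty Borel regions indexed by `ι`. -/
structure RegionPartition {n : ℕ} (X : Set (Fin n → ℝ)) (ι : Type*) where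
  cell : ι → Set (Fin n → ℝ)
  measurableSet_cell : ∀ i, MeasurableSet (cell i)
  nonempty_cell : ∀ i, (cell i).Nonempty
  disjoint_cell : ∀ i j, i ≠ j → Disjoint (cell i) (cell j)
  iUnion_cell : ⋃ i, cell i = X

/-- The region of `ℝⁿ` belonging to an abstract state: a cell of the partition, or (`none`) the
extra region `ℝⁿ ∖ X`. -/
def RegionPartition.region {n : ℕ} {X : Set (Fin n → ℝ)} {ι : Type*}
    (R : RegionPartition X ι) : Option ι → Set (Fin n → ℝ)
  | some i => R.cell i
  | none => Xᶜ

/-- `I` is an IMDP abstraction of `M` over the regions of `R` (including `ℝⁿ ∖ X`): labels agree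
with those of `M` on each region, and the intervals contain the transition probabilities
`T(x, a, q')` of all `x ∈ q`. -/
structure IsAbstraction {n : ℕ} {U AP ι : Type*} (M : ContMDP n U AP)
    (R : RegionPartition M.X ι) (I : IMDP (Option ι) U AP) : Prop where
  label_eq : ∀ q, ∀ x ∈ R.region q, I.label q = M.label x
  lower_le : ∀ q a q', ∀ x ∈ R.region q, I.lower q a q' ≤ (M.T x a).real (R.region q')
  le_upper : ∀ q a q', ∀ x ∈ R.region q, (M.T x a).real (R.region q') ≤ I.upper q a q'

/-- The policy `π` of `M` and the stationary policy `πI` of the product IMDP are the same policy: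
whenever the current state `x_k` lies in region `q` and the automaton, having read the labels of
`x₀ … x_{k-1}`, is in state `z`, the policy `π` plays `πI (q, z)`. In particular `π` depends on the
current state only through its region. -/
def Policy.Agrees {n : ℕ} {U AP ι Z : Type*} {M : ContMDP n U AP} (R : RegionPartition M.X ι)
    (A : DFA (Set AP) Z) (π : Policy n U) (πI : Option ι × Z → U) : Prop :=
  ∀ (ω : ℕ → (Fin n → ℝ)) (k : ℕ) (q : Option ι), ω k ∈ R.region q →
    π.act k (fun i => ω i) = πI (q, dfaRun A (fun i => M.label (ω i)) k)

end Shield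

/-! By the abstraction property, from any point `x` of a region `M` moves like some adversary. But
the rows of that adversary depend on `x`, hence on the history, while the supremum in the hypothesis
ranges over stationary adversaries. The core of the proof is that varying the adversary along the
path gains nothing.

By the automaton, violating `φ` means reaching a final state. Let `v` be the least fixed point of
the Bellman operator of worst-case reachability with discount `β < 1`. Two bounds meet at `v`. Upper
(`pow_mul_condLaw_hitWithin_le`): at each point of `M` the induced adversary competes in the
supremum defining `v`, so by induction `β ^ m` times the probability that `M` reaches a final state
within `m` steps is at most `v`. Lower (`discountedReach_le_worstViolationProb`): for `β < γ < 1`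
one stationary adversary satisfies `v ≤ γ * E v` at every non-final state. Unrolling `m` times
bounds `v` by its reachability probability plus `γ ^ m`, and `m → ∞` removes the error. Without
discounting, an adversary that is greedy for `v` could cycle forever and never reach the target.
Letting `β → 1` with `m` fixed, and then taking the supremum over `m`, compares the two violation
probabilities; the strict bound by `p` follows. -/

namespace Shield

/-! ### Conditional path laws and hitting events -/

section Path

variable {E : Type*} [MeasurableSpace E]

/-- The law of the future path given that the path coincides with `ω` up to time `k`. -/
noncomputable def condLaw (κ : (k : ℕ) → Kernel (Finset.Iic k → E) E) [∀ k, IsMarkovKernel (κ k)]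
    (k : ℕ) (ω : ℕ → E) : Measure (ℕ → E) :=
  Kernel.traj (X := fun _ => E) κ k (fun i => ω i)

variable (κ : (k : ℕ) → Kernel (Finset.Iic k → E) E) [∀ k, IsMarkovKernel (κ k)]

instance (k : ℕ) (ω : ℕ → E) : IsProbabilityMeasure (condLaw κ k ω) :=
  inferInstanceAs (IsProbabilityMeasure (Kernel.traj (X := fun _ => E) κ k (fun i => ω i)))

/-- Under the law given the past, the past is almost surely the given one. -/
lemma ae_condLaw_eq_past [MeasurableSingletonClass E] (k : ℕ) (ω : ℕ → E) :
    ∀ᵐ ω' ∂condLaw κ k ω, ∀ i ≤ k, ω' i = ω i := by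
  have h := Kernel.traj_map_frestrictLe_apply (X := fun _ => E) (κ := κ) k k (fun i => ω i)
  rw [Kernel.partialTraj_self, Kernel.id_apply] at h
  have h2 : ∀ᵐ y ∂((condLaw κ k ω).map (Preorder.frestrictLe (π := fun _ => E) k)),
      y = fun i : Finset.Iic k => ω i := by
    rw [condLaw, h, ae_dirac_eq]
    rfl
  filter_upwards [ae_of_ae_map (by fun_prop) h2] with ω' h3 i hi
  exact congrFun h3 ⟨i, Finset.mem_Iic.2 hi⟩

/-- The Markov property: conditioning on one more state. -/
lemma condLaw_apply_eq_lintegral (k : ℕ) (ω : ℕ → E) {B : Set (ℕ → E)} (hB : MeasurableSet B) :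
    condLaw κ k ω B =
      ∫⁻ y, condLaw κ (k + 1) (Function.update ω (k + 1) y) B ∂κ k (fun i => ω i) := by
  have hm : Measurable fun h => Kernel.traj (X := fun _ => E) κ (k + 1) h B :=
    Kernel.measurable_coe _ hB
  have hg : Measurable (IicProdIoc (X := fun _ => E) k (k + 1)) := measurable_IicProdIoc
  have hmg : Measurable fun a => Kernel.traj (X := fun _ => E) κ (k + 1)
      (IicProdIoc (X := fun _ => E) k (k + 1) a) B := hm.comp hg
  rw [condLaw, ← Kernel.traj_comp_partialTraj (X := fun _ => E) (κ := κ) (Nat.le_succ k),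
    Kernel.comp_apply' _ _ _ hB, Nat.succ_eq_add_one, Kernel.partialTraj_succ_self,
    Kernel.lintegral_map _ hg _ hm, Kernel.lintegral_prod _ _ _ hmg, Kernel.id_apply,
    lintegral_dirac' _ (by fun_prop), Kernel.lintegral_map _ (by fun_prop) _ (by fun_prop)]
  refine lintegral_congr fun y => ?_
  rw [condLaw]
  congr 2
  funext i
  -- Coordinates up to `k` come from the past `ω`; the only other one, `k + 1`, is the new state
  -- `y`.
  by_cases hi : (i : ℕ) ≤ k
  · simp [IicProdIoc, hi, Function.update_of_ne (show (i : ℕ) ≠ k + 1 by omega)]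
  · obtain ⟨i, hi'⟩ := i
    obtain rfl : i = k + 1 := by
      have := Finset.mem_Iic.1 hi'
      simp at hi
      omega
    simp [IicProdIoc, MeasurableEquiv.piSingleton]

/-- The paths that meet the events `F i` at some time `k ≤ i < k + m`. -/
def hitWithin {Ω : Type*} (F : ℕ → Set Ω) (k m : ℕ) : Set Ω :=
  {ω | ∃ i, k ≤ i ∧ i < k + m ∧ ω ∈ F i}

@[simp] lemma hitWithin_zero {Ω : Type*} (F : ℕ → Set Ω) (k : ℕ) : hitWithin F k 0 = ∅ := by
  ext ω
  simp only [hitWithin, Set.mem_ofPred_eq, Set.mem_empty_iff_false, iff_false]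
  rintro ⟨i, h1, h2, -⟩
  omega

lemma hitWithin_succ {Ω : Type*} (F : ℕ → Set Ω) (k m : ℕ) :
    hitWithin F k (m + 1) = F k ∪ hitWithin F (k + 1) m := by
  ext ω
  simp only [hitWithin, Set.mem_ofPred_eq, Set.mem_union]
  constructor
  · rintro ⟨i, h1, h2, h3⟩
    rcases h1.eq_or_lt with rfl | h1
    · exact .inl h3
    · exact .inr ⟨i, h1, by omega, h3⟩
  · rintro (h | ⟨i, h1, h2, h3⟩)
    · exact ⟨k, le_rfl, by omega, h⟩
    · exact ⟨i, by omega, by omega, h3⟩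

lemma measurableSet_hitWithin {Ω : Type*} [MeasurableSpace Ω] {F : ℕ → Set Ω}
    (hF : ∀ i, MeasurableSet (F i)) (k m : ℕ) : MeasurableSet (hitWithin F k m) := by
  induction m generalizing k with
  | zero => simp
  | succ m ih => rw [hitWithin_succ]; exact (hF k).union (ih _)

lemma measure_iUnion_eq_iSup_hitWithin {Ω : Type*} [MeasurableSpace Ω] (μ : Measure Ω)
    (F : ℕ → Set Ω) : μ (⋃ i, F i) = ⨆ m, μ (hitWithin F 0 m) := by
  have h : (⋃ i, F i) = ⋃ m, hitWithin F 0 m := by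
    ext ω
    simp only [hitWithin, Set.mem_iUnion, Set.mem_ofPred_eq]
    exact ⟨fun ⟨i, hi⟩ => ⟨i + 1, i, by omega, by omega, hi⟩, fun ⟨_, i, _, _, hi⟩ => ⟨i, hi⟩⟩
  rw [h]
  refine Monotone.measure_iUnion fun a b hab ω => ?_
  rintro ⟨i, h1, h2, h3⟩
  exact ⟨i, h1, by omega, h3⟩

/-- `F i` is an event about the path up to time `i`. -/
def IsAdaptedEvents (F : ℕ → Set (ℕ → E)) : Prop :=
  ∀ i ω ω', (∀ j ≤ i, ω j = ω' j) → ω ∈ F i → ω' ∈ F i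

/-- An adapted event at time `k` is decided by the past, which is almost surely that of `ω`. This
and the next lemma are the two cases of the one-step recursion for reachability. -/
lemma condLaw_hitWithin_succ_of_mem [MeasurableSingletonClass E] {F : ℕ → Set (ℕ → E)}
    (hF : IsAdaptedEvents F) {k m : ℕ} {ω : ℕ → E} (hω : ω ∈ F k) :
    condLaw κ k ω (hitWithin F k (m + 1)) = 1 := by
  rw [← measure_univ (μ := condLaw κ k ω)]
  refine measure_congr ?_
  filter_upwards [ae_condLaw_eq_past κ k ω] with ω' h
  refine propext ⟨fun _ => trivial, fun _ => ?_⟩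
  change ω' ∈ hitWithin F k (m + 1)
  rw [hitWithin_succ]
  exact .inl (hF k ω ω' (fun j hj => (h j hj).symm) hω)

lemma condLaw_hitWithin_succ_of_notMem [MeasurableSingletonClass E] {F : ℕ → Set (ℕ → E)}
    (hFm : ∀ i, MeasurableSet (F i)) (hF : IsAdaptedEvents F) {k m : ℕ} {ω : ℕ → E}
    (hω : ω ∉ F k) :
    condLaw κ k ω (hitWithin F k (m + 1)) =
      ∫⁻ y, condLaw κ (k + 1) (Function.update ω (k + 1) y) (hitWithin F (k + 1) m)
        ∂κ k (fun i => ω i) := by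
  rw [← condLaw_apply_eq_lintegral κ k ω (measurableSet_hitWithin hFm _ _)]
  refine measure_congr ?_
  filter_upwards [ae_condLaw_eq_past κ k ω] with ω' h
  change (ω' ∈ hitWithin F k (m + 1)) = (ω' ∈ hitWithin F (k + 1) m)
  rw [hitWithin_succ]
  exact propext ⟨fun h' => h'.resolve_left fun h'' => hω (hF k ω' ω h h''), .inr⟩

end Path

/-! ### Acceptance by the automaton as a hitting event -/

section Automaton

variable {Q AP Z E : Type*}

/-- The paths whose labels, read by `A`, lead to a final state at time `i`. -/
def acceptAt (A : DFA (Set AP) Z) (ℓ : E → Set AP) (i : ℕ) : Set (ℕ → E) :=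
  {ω | dfaRun A (fun j => ℓ (ω j)) i ∈ A.accept}

lemma dfaRun_congr (A : DFA (Set AP) Z) {ρ ρ' : ℕ → Set AP} {i : ℕ}
    (h : ∀ j < i, ρ j = ρ' j) : dfaRun A ρ i = dfaRun A ρ' i := by
  induction i with
  | zero => rfl
  | succ i ih => rw [dfaRun, dfaRun, ih fun j hj => h j (by omega), h i (by omega)]

lemma isAdaptedEvents_acceptAt (A : DFA (Set AP) Z) (ℓ : E → Set AP) :
    IsAdaptedEvents (acceptAt A ℓ) := by
  intro i ω ω' h hω
  rw [acceptAt, Set.mem_ofPred_eq] at hω ⊢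
  rwa [← dfaRun_congr A fun j hj => congrArg ℓ (h j hj.le)]

/-- The automaton state after reading a path is measurable when the labels factor through a
measurable map to a finite set. -/
lemma measurableSet_acceptAt [MeasurableSpace E] [Finite Q] [Finite Z] (A : DFA (Set AP) Z)
    {ℓ : E → Set AP} (c : E → Q) (hc : ∀ q, MeasurableSet (c ⁻¹' {q})) (L : Q → Set AP)
    (hL : ∀ x, ℓ x = L (c x)) (i : ℕ) : MeasurableSet (acceptAt A ℓ i) := by
  let _ : MeasurableSpace Q := ⊤
  let _ : MeasurableSpace Z := ⊤
  have hcm : Measurable c := measurable_to_countable' hc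
  have key : ∀ i, Measurable fun ω : ℕ → E => dfaRun A (fun j => ℓ (ω j)) i := by
    intro i
    induction i with
    | zero => exact measurable_const
    | succ i ih =>
      have : (fun ω : ℕ → E => dfaRun A (fun j => ℓ (ω j)) (i + 1)) =
          (fun s : Z × Q => A.step s.1 (L s.2)) ∘
            fun ω => (dfaRun A (fun j => ℓ (ω j)) i, c (ω i)) := by
        funext ω
        simp [dfaRun, hL]
      rw [this]
      exact (measurable_of_countable _).comp (ih.prodMk (hcm.comp (measurable_pi_apply i)))
  exact key i (MeasurableSet.of_discrete (s := A.accept))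

lemma setOf_not_sat_eq_iUnion {φ : SafeLTL AP} {A : DFA (Set AP) Z} (hA : IsDFAForNegation A φ)
    (ℓ : E → Set AP) :
    {ω : ℕ → E | ¬ φ.Sat fun i => ℓ (ω i)} = ⋃ i, acceptAt A ℓ i := by
  ext ω
  simp only [Set.mem_ofPred_eq, Set.mem_iUnion, acceptAt, ← hA fun i => ℓ (ω i)]

end Automaton

/-! ### Discounted worst-case reachability in interval MDPs -/

namespace IMDP

variable {S U AP : Type*} [Fintype S] {I : IMDP S U AP}

/-- The expectation of `v` at the next state. -/
noncomputable def Adversary.expect (Δ : I.Adversary) (s : S) (a : U) (v : S → ℝ≥0∞) : ℝ≥0∞ :=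
  ∑ s', ENNReal.ofReal (Δ.prob s a s') * v s'

lemma Adversary.expect_mono (Δ : I.Adversary) (s : S) (a : U) {v w : S → ℝ≥0∞}
    (h : ∀ s, v s ≤ w s) : Δ.expect s a v ≤ Δ.expect s a w :=
  Finset.sum_le_sum fun s' _ => mul_le_mul_right (h s') _

lemma Adversary.expect_const (Δ : I.Adversary) (s : S) (a : U) (c : ℝ≥0∞) :
    Δ.expect s a (fun _ => c) = c := by
  have h0 : ∀ s' ∈ Finset.univ, 0 ≤ Δ.prob s a s' := fun s' _ =>
    (I.lower_mem s a s').1.trans (Δ.lower_le s a s')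
  rw [expect, ← Finset.sum_mul, ← ENNReal.ofReal_sum_of_nonneg h0, Δ.sum_eq_one]
  simp

lemma Adversary.expect_add (Δ : I.Adversary) (s : S) (a : U) (v w : S → ℝ≥0∞) :
    Δ.expect s a (fun s => v s + w s) = Δ.expect s a v + Δ.expect s a w := by
  simp only [expect, mul_add, Finset.sum_add_distrib]

lemma Adversary.lintegral_next [MeasurableSpace S] [DiscreteMeasurableSpace S] (Δ : I.Adversary)
    (s : S) (a : U) (v : S → ℝ≥0∞) : ∫⁻ s', v s' ∂Δ.next s a = Δ.expect s a v := by
  simp [Adversary.next, expect]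

open Classical in
/-- The Bellman operator of `β`-discounted worst-case reachability of `F` under `π`. -/
noncomputable def bellman (I : IMDP S U AP) (π : S → U) (F : Set S) (β : ℝ≥0∞) :
    (S → ℝ≥0∞) →o (S → ℝ≥0∞) where
  toFun v s := if s ∈ F then 1 else ⨆ Δ : I.Adversary, β * Δ.expect s (π s) v
  monotone' v w h s := by
    dsimp only
    split_ifs
    · exact le_rfl
    · exact iSup_mono fun Δ => mul_le_mul_right (Δ.expect_mono _ _ h) _

/-- The `β`-discounted worst-case probability of reaching `F` under `π`. -/
noncomputable def discountedReach (I : IMDP S U AP) (π : S → U) (F : Set S) (β : ℝ≥0∞) :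
    S → ℝ≥0∞ :=
  (I.bellman π F β).lfp

variable (I) (π : S → U) (F : Set S) {β : ℝ≥0∞}

lemma discountedReach_of_mem {s : S} (hs : s ∈ F) : I.discountedReach π F β s = 1 := by
  rw [discountedReach, ← OrderHom.map_lfp]
  exact if_pos hs

lemma discountedReach_of_notMem {s : S} (hs : s ∉ F) :
    I.discountedReach π F β s =
      ⨆ Δ : I.Adversary, β * Δ.expect s (π s) (I.discountedReach π F β) := by
  conv_lhs => rw [discountedReach, ← OrderHom.map_lfp]
  exact if_neg hs

/-- The constant function `1` is a pre-fixed point of the Bellman operator. -/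
lemma discountedReach_le_one (hβ : β ≤ 1) (s : S) : I.discountedReach π F β s ≤ 1 := by
  refine OrderHom.lfp_le (I.bellman π F β) (a := fun _ => 1) (fun s => ?_) s
  classical
  change (if s ∈ F then 1 else _) ≤ _
  split_ifs
  · exact le_rfl
  · exact iSup_le fun Δ => by rw [Δ.expect_const, mul_one]; exact hβ

/-- For a slightly larger discount factor, one adversary does as well at every state as the
worst case. -/
lemma exists_adversary_discountedReach_le [Nonempty I.Adversary] {γ : ℝ≥0∞} (hβγ : β < γ)
    (hγ : γ ≤ 1) :
    ∃ Δ : I.Adversary, ∀ s ∉ F, I.discountedReach π F β s ≤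
      γ * Δ.expect s (π s) (I.discountedReach π F β) := by
  set v := I.discountedReach π F β with hv
  have key : ∀ s, ∃ Δ : I.Adversary, s ∉ F → v s ≤ γ * Δ.expect s (π s) v := by
    intro s
    by_cases hs : s ∈ F
    · exact ⟨Classical.arbitrary _, fun h => absurd hs h⟩
    · have hvs := I.discountedReach_of_notMem π F (β := β) hs
      rw [← hv, ← ENNReal.mul_iSup] at hvs
      set t := ⨆ Δ : I.Adversary, Δ.expect s (π s) v with ht
      have ht1 : t ≤ 1 := iSup_le fun Δ => (Δ.expect_mono _ _
        (I.discountedReach_le_one π F (hβγ.le.trans hγ))).trans (Δ.expect_const _ _ 1).le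
      -- The strict gap `β * t < γ * t`, which yields a near-optimal adversary without attainment of
      -- the supremum, needs `t ≠ 0`; if `t = 0`, then `v s = 0` and any adversary will do.
      rcases eq_or_ne t 0 with h0 | h0
      · exact ⟨Classical.arbitrary _, fun _ => by simp [hvs, h0]⟩
      · have hlt : v s < ⨆ Δ : I.Adversary, γ * Δ.expect s (π s) v := by
          rw [← ENNReal.mul_iSup, hvs]
          exact (ENNReal.mul_lt_mul_iff_left h0 (ht1.trans_lt ENNReal.one_lt_top).ne).2 hβγ
        obtain ⟨Δ, hΔ⟩ := lt_iSup_iff.1 hlt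
        exact ⟨Δ, fun _ => hΔ.le⟩
  choose D hD using key
  -- The interval constraints bind each row separately, so rows taken from different adversaries
  -- form one stationary adversary.
  exact ⟨⟨fun s => (D s).prob s, fun s => (D s).sum_eq_one s, fun s => (D s).lower_le s,
    fun s => (D s).le_upper s⟩, hD⟩

end IMDP

/-! ### The product with the automaton -/

section Product

variable {Q U AP Z : Type*} [Fintype Q] [Fintype Z] {I : IMDP Q U AP} {A : DFA (Set AP) Z}

/-- The product states in which the automaton is in a final state. -/
def acceptStates (Q : Type*) (A : DFA (Set AP) Z) : Set (Q × Z) := {s | s.2 ∈ A.accept}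

lemma product_prob_eq_zero (Δ : (I.product A).Adversary) {s s' : Q × Z} (a : U)
    (h : s'.2 ≠ A.step s.2 (I.label s.1)) : Δ.prob s a s' = 0 := by
  have h1 := Δ.lower_le s a s'
  have h2 := Δ.le_upper s a s'
  simp only [IMDP.product, if_neg h] at h1 h2
  exact le_antisymm h2 h1

/-- An adversary that is `γ`-optimal at every state reaches `F` within `m` steps with at least
the discounted value, up to `γ ^ m`. -/
lemma le_condLaw_hitWithin_add_pow [MeasurableSpace (Q × Z)] [DiscreteMeasurableSpace (Q × Z)]
    (Δ : (I.product A).Adversary) (πI : Q × Z → U) {v : Q × Z → ℝ≥0∞} {γ : ℝ≥0∞} (hγ : γ ≤ 1)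
    (hv1 : ∀ s, v s ≤ 1)
    (hv : ∀ s ∉ acceptStates Q A, v s ≤ γ * Δ.expect s (πI s) v) (m k : ℕ) (ω : ℕ → Q × Z)
    (hω : (ω k).2 = dfaRun A (fun i => (I.product A).label (ω i)) k) :
    v (ω k) ≤ condLaw (Δ.stepKernel πI) k ω
      (hitWithin (acceptAt A (I.product A).label) k m) + γ ^ m := by
  have hFm : ∀ i, MeasurableSet (acceptAt A (I.product A).label i) :=
    measurableSet_acceptAt A id (fun _ => .of_discrete) (I.product A).label fun _ => rfl
  induction m generalizing k ω with
  | zero => simpa using hv1 (ω k)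
  | succ m ih =>
    by_cases hmem : ω k ∈ acceptStates Q A
    · rw [condLaw_hitWithin_succ_of_mem _ (isAdaptedEvents_acceptAt A _)]
      · exact (hv1 _).trans le_self_add
      · change dfaRun A _ k ∈ A.accept
        rwa [← hω]
    · have hnm : ω ∉ acceptAt A (I.product A).label k := by
        change dfaRun A _ k ∉ A.accept
        rwa [← hω]
      rw [condLaw_hitWithin_succ_of_notMem _ hFm (isAdaptedEvents_acceptAt A _) hnm]
      change _ ≤ ∫⁻ y, _ ∂Δ.next (ω k) (πI (ω k)) + _
      rw [Δ.lintegral_next]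
      calc v (ω k) ≤ γ * Δ.expect (ω k) (πI (ω k)) v := hv _ hmem
        _ ≤ γ * (Δ.expect (ω k) (πI (ω k)) fun y =>
              condLaw (Δ.stepKernel πI) (k + 1) (Function.update ω (k + 1) y)
                (hitWithin (acceptAt A (I.product A).label) (k + 1) m) + γ ^ m) := by
            refine mul_le_mul_right (Finset.sum_le_sum fun y _ => ?_) _
            -- The induction hypothesis needs the automaton component to follow the run; successors
            -- that break this have probability zero.
            by_cases hy : y.2 = A.step (ω k).2 (I.label (ω k).1)
            · refine mul_le_mul_right ?_ _
              have := ih (k + 1) (Function.update ω (k + 1) y) (by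
                rw [Function.update_self, hy, dfaRun, hω,
                  Function.update_of_ne (Nat.lt_succ_self k).ne]
                congr 1
                refine dfaRun_congr A fun j hj => ?_
                rw [Function.update_of_ne (by omega)])
              rwa [Function.update_self] at this
            · simp [product_prob_eq_zero Δ _ hy]
        _ ≤ _ := by
            -- The factor `γ` is kept on the error, giving `γ ^ (m + 1)`, and dropped from the
            -- probability.
            rw [Δ.expect_add, Δ.expect_const, mul_add, pow_succ']
            exact add_le_add_left (mul_le_of_le_one_left' hγ) _

/-- The slack between `β` and an intermediate `γ < 1` pays for choosing a single adversary, and `γ ^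
m → 0` removes the truncation error. -/
lemma discountedReach_le_worstViolationProb [Nonempty (I.product A).Adversary]
    {φ : SafeLTL AP} (hA : IsDFAForNegation A φ) (πI : Q × Z → U) {β : ℝ≥0∞} (hβ : β < 1)
    (q : Q) :
    (I.product A).discountedReach πI (acceptStates Q A) β (q, A.start) ≤
      (I.product A).worstViolationProb πI φ (q, A.start) := by
  obtain ⟨γ, hβγ, hγ⟩ := exists_between hβ
  obtain ⟨Δ, hΔ⟩ := (I.product A).exists_adversary_discountedReach_le πI (acceptStates Q A)
    hβγ hγ.le
  refine le_trans ?_ (le_iSup _ Δ)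
  let _ : MeasurableSpace (Q × Z) := ⊤
  have : DiscreteMeasurableSpace (Q × Z) := ⟨fun _ => trivial⟩
  change _ ≤ pathLaw (Δ.stepKernel πI) (q, A.start) {ω | ¬ φ.Sat fun i => (I.product A).label (ω i)}
  rw [setOf_not_sat_eq_iUnion hA, measure_iUnion_eq_iSup_hitWithin]
  have hlim : Filter.Tendsto (fun m : ℕ => (⨆ m, pathLaw (Δ.stepKernel πI) (q, A.start)
      (hitWithin (acceptAt A (I.product A).label) 0 m)) + γ ^ m) Filter.atTop
      (nhds ((⨆ m, pathLaw (Δ.stepKernel πI) (q, A.start)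
        (hitWithin (acceptAt A (I.product A).label) 0 m)) + 0)) :=
    (ENNReal.tendsto_pow_atTop_nhds_zero_of_lt_one hγ).const_add _
  rw [add_zero] at hlim
  refine ge_of_tendsto' hlim fun m => ?_
  -- At time `0` only the initial state of the path matters, so a constant path serves.
  refine (le_condLaw_hitWithin_add_pow Δ πI hγ.le
    ((I.product A).discountedReach_le_one πI _ hβ.le) hΔ m 0 (fun _ => (q, A.start)) rfl).trans ?_
  gcongr
  exact le_iSup (fun m => pathLaw (Δ.stepKernel πI) (q, A.start)
      (hitWithin (acceptAt A (I.product A).label) 0 m)) m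

end Product

/-! ### Regions and the adversaries they induce -/

namespace RegionPartition

variable {n : ℕ} {X : Set (Fin n → ℝ)} {ι : Type*} (R : RegionPartition X ι)

lemma exists_mem_region (x : Fin n → ℝ) : ∃ q, x ∈ R.region q := by
  by_cases hx : x ∈ X
  · rw [← R.iUnion_cell] at hx
    obtain ⟨i, hi⟩ := Set.mem_iUnion.1 hx
    exact ⟨some i, hi⟩
  · exact ⟨none, hx⟩

lemma eq_of_mem_region {x : Fin n → ℝ} {q q' : Option ι} (h : x ∈ R.region q)
    (h' : x ∈ R.region q') : q = q' := by
  have hcell : ∀ i, x ∈ R.cell i → x ∈ X := fun i hi =>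
    R.iUnion_cell ▸ Set.mem_iUnion.2 ⟨i, hi⟩
  match q, q', h, h' with
  | none, none, _, _ => rfl
  | some i, none, h, h' => exact absurd (hcell i h) h'
  | none, some i, h, h' => exact absurd (hcell i h') h
  | some i, some j, h, h' =>
    by_contra hij
    exact Set.disjoint_left.1 (R.disjoint_cell i j fun e => hij (e ▸ rfl)) h h'

/-- The region in which a state lies. -/
noncomputable def index (x : Fin n → ℝ) : Option ι := (R.exists_mem_region x).choose

lemma mem_region_index (x : Fin n → ℝ) : x ∈ R.region (R.index x) :=
  (R.exists_mem_region x).choose_spec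

lemma index_preimage (q : Option ι) : R.index ⁻¹' {q} = R.region q := by
  ext x
  exact ⟨fun h => h ▸ R.mem_region_index x, fun h => R.eq_of_mem_region (R.mem_region_index x) h⟩

lemma measurableSet_region (hX : IsCompact X) (q : Option ι) : MeasurableSet (R.region q) :=
  match q with
  | some i => R.measurableSet_cell i
  | none => hX.measurableSet.compl

/-- An induced adversary needs a representative point in every region. For the outer one this holds
because `ℝⁿ` with `n > 0` is not compact. -/
lemma region_nonempty (hn : 0 < n) (hX : IsCompact X) (q : Option ι) : (R.region q).Nonempty :=
  match q with
  | some i => R.nonempty_cell i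
  | none => by
    have : Nonempty (Fin n) := ⟨⟨0, hn⟩⟩
    exact Set.nonempty_compl.2 hX.ne_univ

/-- Integrating a function of the region. -/
lemma lintegral_comp_index [Fintype ι] (hX : IsCompact X) (μ : Measure (Fin n → ℝ))
    (g : Option ι → ℝ≥0∞) :
    ∫⁻ x, g (R.index x) ∂μ = ∑ q, μ (R.region q) * g q := by
  let _ : MeasurableSpace (Option ι) := ⊤
  have hm : Measurable R.index := measurable_to_countable' fun q => by
    rw [R.index_preimage]
    exact R.measurableSet_region hX q
  rw [← lintegral_map (f := g) (measurable_of_countable _) hm, lintegral_fintype]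
  refine Finset.sum_congr rfl fun q _ => ?_
  rw [Measure.map_apply hm (MeasurableSet.singleton q), R.index_preimage, mul_comm]

lemma sum_measureReal_region [Fintype ι] (hX : IsCompact X) (μ : Measure (Fin n → ℝ))
    [IsProbabilityMeasure μ] : ∑ q, μ.real (R.region q) = 1 := by
  have h := R.lintegral_comp_index hX μ fun _ => 1
  simp only [lintegral_const, measure_univ, mul_one] at h
  simp only [Measure.real]
  rw [← ENNReal.toReal_sum fun q _ => measure_ne_top μ _, ← h, ENNReal.toReal_one]

end RegionPartition

/-! ### Comparison of `M` with the product -/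

section Abstraction

variable {n : ℕ} {U AP ι Z : Type*} [Fintype ι] [Fintype Z] {M : ContMDP n U AP}
  {R : RegionPartition M.X ι} {I : IMDP (Option ι) U AP}

open Classical in
/-- The adversary that moves like `M` does from a chosen state of each region. -/
noncomputable def IsAbstraction.adversary (hI : IsAbstraction M R I) (A : DFA (Set AP) Z)
    (r : Option ι → Fin n → ℝ) (hr : ∀ q, r q ∈ R.region q) : (I.product A).Adversary where
  prob s a s' := if s'.2 = A.step s.2 (I.label s.1) then (M.T (r s.1) a).real (R.region s'.1) else 0
  sum_eq_one s a := by
    rw [Fintype.sum_prod_type]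
    simp [R.sum_measureReal_region M.isCompact_X]
  lower_le s a s' := by
    simp only [IMDP.product]
    split_ifs
    · exact hI.lower_le _ _ _ _ (hr _)
    · exact le_rfl
  le_upper s a s' := by
    simp only [IMDP.product]
    split_ifs
    · exact hI.le_upper _ _ _ _ (hr _)
    · exact le_rfl

lemma IsAbstraction.expect_adversary (hI : IsAbstraction M R I) (A : DFA (Set AP) Z)
    (r : Option ι → Fin n → ℝ) (hr : ∀ q, r q ∈ R.region q) (s : Option ι × Z) (a : U)
    (v : Option ι × Z → ℝ≥0∞) :
    (hI.adversary A r hr).expect s a v =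
      ∫⁻ y, v (R.index y, A.step s.2 (I.label s.1)) ∂M.T (r s.1) a := by
  rw [R.lintegral_comp_index M.isCompact_X _ fun q => v (q, A.step s.2 (I.label s.1)),
    IMDP.Adversary.expect, Fintype.sum_prod_type]
  refine Finset.sum_congr rfl fun q _ => ?_
  rw [Finset.sum_eq_single (A.step s.2 (I.label s.1))]
  · simp [IsAbstraction.adversary]
  · intro z _ hz
    simp [IsAbstraction.adversary, hz]
  · simp

/-- The representative of the region of `x` is taken to be `x` itself; the other representatives are
arbitrary, since only the rows at that region enter. -/
lemma IsAbstraction.exists_adversary (hI : IsAbstraction M R I) (hn : 0 < n) (A : DFA (Set AP) Z)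
    (x : Fin n → ℝ) :
    ∃ Δ : (I.product A).Adversary, ∀ (z : Z) (a : U) (v : Option ι × Z → ℝ≥0∞),
      Δ.expect (R.index x, z) a v =
        ∫⁻ y, v (R.index y, A.step z (I.label (R.index x))) ∂M.T x a := by
  classical
  choose r hr using R.region_nonempty hn M.isCompact_X
  refine ⟨hI.adversary A (Function.update r (R.index x) x) fun q => ?_, fun z a v => ?_⟩
  · rcases eq_or_ne q (R.index x) with rfl | h
    · rw [Function.update_self]
      exact R.mem_region_index x
    · rw [Function.update_of_ne h]
      exact hr q
  · rw [hI.expect_adversary, Function.update_self]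

/-- The discounted worst-case value of the product bounds the probability that `M` makes the
automaton accept within `m` steps. -/
lemma pow_mul_condLaw_hitWithin_le [Countable U] (hn : 0 < n) (hI : IsAbstraction M R I)
    {A : DFA (Set AP) Z} {πI : Option ι × Z → U} {π : Policy n U} (hπ : π.Agrees R A πI)
    {β : ℝ≥0∞} (hβ : β ≤ 1) (m k : ℕ) (ω : ℕ → Fin n → ℝ) :
    β ^ m * condLaw (M.stepKernel π) k ω (hitWithin (acceptAt A M.label) k m) ≤
      (I.product A).discountedReach πI (acceptStates (Option ι) A) β
        (R.index (ω k), dfaRun A (fun i => M.label (ω i)) k) := by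
  have hlabel : ∀ x, M.label x = I.label (R.index x) := fun x =>
    (hI.label_eq _ x (R.mem_region_index x)).symm
  have hFm : ∀ i, MeasurableSet (acceptAt A M.label i) :=
    measurableSet_acceptAt A R.index
      (fun q => R.index_preimage q ▸ R.measurableSet_region M.isCompact_X q) I.label hlabel
  induction m generalizing k ω with
  | zero => simp
  | succ m ih =>
    by_cases hmem : ω ∈ acceptAt A M.label k
    · rw [IMDP.discountedReach_of_mem _ _ _ (by exact hmem)]
      exact mul_le_one' (pow_le_one' hβ _) prob_le_one
    -- `Δ` depends on the point `ω k`, not just on its region; this is harmless because the Bellman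
    -- supremum is taken afresh at each step.
    · obtain ⟨Δ, hΔ⟩ := hI.exists_adversary hn A (ω k)
      rw [IMDP.discountedReach_of_notMem _ _ _ (by exact hmem),
        condLaw_hitWithin_succ_of_notMem _ hFm (isAdaptedEvents_acceptAt A _) hmem]
      refine le_trans ?_ (le_iSup _ Δ)
      change _ * ∫⁻ y, _ ∂M.T (ω k) (π.act k fun i => ω i) ≤ _
      rw [hΔ, hπ ω k _ (R.mem_region_index (ω k)), pow_succ', mul_assoc]
      refine mul_le_mul_right ?_ _
      -- Finiteness of `β ^ m` lets it enter the integral without measurability of the integrand.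
      rw [← lintegral_const_mul' _ _ (ENNReal.pow_ne_top (hβ.trans_lt ENNReal.one_lt_top).ne)]
      refine lintegral_mono fun y => ?_
      refine (ih (k + 1) (Function.update ω (k + 1) y)).trans_eq ?_
      rw [Function.update_self, dfaRun, Function.update_of_ne (Nat.lt_succ_self k).ne, hlabel (ω k)]
      congr 3
      refine dfaRun_congr A fun j hj => ?_
      rw [Function.update_of_ne (by omega)]

lemma violationProb_le_worstViolationProb [Countable U] (hn : 0 < n) (hI : IsAbstraction M R I)
    {φ : SafeLTL AP} {A : DFA (Set AP) Z} (hA : IsDFAForNegation A φ)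
    {πI : Option ι × Z → U} {π : Policy n U} (hπ : π.Agrees R A πI) {q : Option ι}
    {x₀ : Fin n → ℝ} (hx₀ : x₀ ∈ R.region q) :
    M.violationProb π φ x₀ ≤ (I.product A).worstViolationProb πI φ (q, A.start) := by
  have : Nonempty (I.product A).Adversary := ⟨(hI.exists_adversary hn A x₀).choose⟩
  rw [ContMDP.violationProb, setOf_not_sat_eq_iUnion hA, measure_iUnion_eq_iSup_hitWithin]
  refine iSup_le fun m => ?_
  set r := pathLaw (M.stepKernel π) x₀ (hitWithin (acceptAt A M.label) 0 m) with hr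
  have hbound : ∀ β : ℝ≥0∞, β < 1 →
      β ^ m * r ≤ (I.product A).worstViolationProb πI φ (q, A.start) := by
    intro β hβ
    refine le_trans ?_ (discountedReach_le_worstViolationProb hA πI hβ q)
    have h := pow_mul_condLaw_hitWithin_le hn hI hπ hβ.le m 0 fun _ => x₀
    rwa [R.eq_of_mem_region (R.mem_region_index x₀) hx₀] at h
  have hr1 : r ≠ ∞ := measure_ne_top (condLaw (M.stepKernel π) 0 fun _ => x₀) _
  -- The horizon `m` is fixed here, so `β ^ m → 1` as `β → 1` from below.
  have hlim : Filter.Tendsto (fun β : ℝ≥0∞ => β ^ m * r) (nhdsWithin 1 (Set.Iio 1))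
      (nhds (1 ^ m * r)) :=
    (ENNReal.Tendsto.mul_const ((ENNReal.continuous_pow m).tendsto 1) (.inr hr1)).mono_left
      nhdsWithin_le_nhds
  rw [one_pow, one_mul] at hlim
  have : (nhdsWithin (1 : ℝ≥0∞) (Set.Iio 1)).NeBot := nhdsLT_neBot_of_exists_lt ⟨0, one_pos⟩
  exact le_of_tendsto hlim (Filter.eventually_of_mem self_mem_nhdsWithin hbound)

end Abstraction

end Shield

theorem theorem3 {n : ℕ} (hn : 0 < n) {U AP ι Z : Type*} [Finite U] [Fintype ι] [Fintype Z]
    (M : Shield.ContMDP n U AP) (R : Shield.RegionPartition M.X ι)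
    (I : Shield.IMDP (Option ι) U AP) (hI : Shield.IsAbstraction M R I)
    (φ : Shield.SafeLTL AP) (A : DFA (Set AP) Z) (hA : Shield.IsDFAForNegation A φ)
    (πI : Option ι × Z → U) (π : Shield.Policy n U) (hπ : π.Agrees R A πI)
    (p : ℝ≥0∞) (q : Option ι)
    (hq : (I.product A).worstViolationProb πI φ (q, A.start) < p) :
    ∀ x₀ ∈ R.region q, M.violationProb π φ x₀ < p := fun _ hx₀ =>
  (Shield.violationProb_le_worstViolationProb hn hI hA hπ hx₀).trans_lt hq
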